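/- \textbf{Conventions.} All functions and distributions are complex-valued and defined on $\mathbb{R}$; $\mathcal{D}$ denotes the space of smooth compactly supported functions. A continuous function $f:\mathbb{R}\to\mathbb{C}$ is \emph{almost automorphic} (written $f\in\mathcal{C}_{aa}$) if every real sequence $(s_m)$ has a subsequence $(s_{m_k})$ such that $g(x):=\lim_{k\to\infty} f(x+s_{m_k})$ exists for every $x\in\mathbb{R}$ and $\lim_{k\to\infty} g(x-s_{m_k})=f(x)$ for every $x\in\mathbb{R}$. For $p\in\mathbb{Z}_+$, $\mathcal{C}^p_{ub}$ is the space of functions $f$ of class $\mathcal{C}^p$ such that $f^{(j)}$ is bounded and uniformly continuous on $\mathbb{R}$ for every $j\le p$. The space $\mathcal{D}_{L^1}$ consists of the $\varphi\in\mathcal{C}^\infty$ all of whose derivatives $\varphi^{(i)}$, $i\ge 0$, lie in $L^1$, with the topology defined by the norms $|\varphi|_{m,1}=\sum_{i=0}^m\|\varphi^{(i)}\|_{L^1}$, $m\in\mathbb{Z}_+$; the space $\mathcal{D}'_{L^\infty}$ of \emph{bounded distributions} is its topological dual. Derivatives and translates of distributions are given by $\langle T',\varphi\rangle=-\langle T,\varphi'\rangle$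 and $\langle\tau_hT,\varphi\rangle=\langle T,\varphi(\cdot-h)\rangle$; for functions $\tau_hf=f(\cdot+h)$. A distribution $T\in\mathcal{D}'_{L^\infty}$ is \emph{almost automorphic} (written $T\in\mathcal{B}'_{aa}$) if $T*\varphi\in\mathcal{C}_{aa}$ for every $\varphi\in\mathcal{D}$, where $(T*\varphi)(x)=\langle T,\varphi(x-\cdot)\rangle$. \textbf{Theorem.} Let $p,q\in\mathbb{Z}_+$, let $a_{ij}\in\mathbb{C}$ for $0\le i\le p$, $0\le j\le q$, let $h_0,\dots,h_q\in\mathbb{R}$, and let $$L_h=\sum_{i=0}^{p}\sum_{j=0}^{q}a_{ij}\,\frac{d^i}{dx^i}\,\tau_{h_j}.$$ Suppose that every solution $f\in\mathcal{C}^p_{ub}$ of the homogeneous equation $L_hf=0$ on $\mathbb{R}$ is an almost automorphic function. Then, for every $S\in\mathcal{B}'_{aa}$, every solution $T\in\mathcal{D}'_{L^\infty}$ of the equation $L_hT=S$ is an almost automorphic distribution. -/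

import Mathlib

open Filter Topology MeasureTheory
open scoped ContDiff Distributions

noncomputable section

namespace AlmostAutomorphy

/-! ### Functions -/

/-- Bochner almost automorphic functions: the class `C_aa`. The limit function `g` is not
required to be continuous. -/
def IsAlmostAutomorphic (f : ℝ → ℂ) : Prop :=
  Continuous f ∧ ∀ s : ℕ → ℝ, ∃ k : ℕ → ℕ, StrictMono k ∧ ∃ g : ℝ → ℂ,
    (∀ x, Tendsto (fun n => f (x + s (k n))) atTop (𝓝 (g x))) ∧
    (∀ x, Tendsto (fun n => g (x - s (k n))) atTop (𝓝 (f x)))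

/-- The class `C^p_ub`: functions of class `C^p` all of whose derivatives of order at most `p`
are uniformly continuous and bounded on `ℝ`. -/
def IsCpub (p : ℕ) (f : ℝ → ℂ) : Prop :=
  ContDiff ℝ p f ∧ ∀ i ≤ p, UniformContinuous (iteratedDeriv i f) ∧
    ∃ C : ℝ, ∀ x, ‖iteratedDeriv i f x‖ ≤ C

/-- The linear difference-differential operator `∑_{i ≤ p} ∑_{j ≤ q} a_{ij} (d/dx)^i τ_{h_j}`
acting on functions, where `(τ_h f) x = f (x + h)`. -/
def opFun {p q : ℕ} (a : Fin (p + 1) → Fin (q + 1) → ℂ) (h : Fin (q + 1) → ℝ)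
    (f : ℝ → ℂ) (x : ℝ) : ℂ :=
  ∑ i : Fin (p + 1), ∑ j : Fin (q + 1), a i j * iteratedDeriv i (fun y => f (y + h j)) x

/-! ### The Fréchet space `D_{L^1}` -/

/-- The smooth functions on `ℝ` all of whose derivatives are integrable, as a subspace. -/
def DL1Submodule : Submodule ℂ (ℝ → ℂ) where
  carrier := {φ | ContDiff ℝ ∞ φ ∧ ∀ i : ℕ, Integrable (iteratedDeriv i φ)}
  zero_mem' := by
    refine ⟨contDiff_const, fun i => ?_⟩
    have : iteratedDeriv i (0 : ℝ → ℂ) = 0 := by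
      funext x
      simp
    rw [this]
    exact integrable_zero _ _ _
  add_mem' := by
    rintro f g ⟨hf, hf'⟩ ⟨hg, hg'⟩
    refine ⟨hf.add hg, fun i => ?_⟩
    have : iteratedDeriv i (f + g) = iteratedDeriv i f + iteratedDeriv i g := by
      funext x
      exact iteratedDeriv_add (hf.contDiffAt.of_le (by exact_mod_cast le_top))
        (hg.contDiffAt.of_le (by exact_mod_cast le_top))
    rw [this]
    exact (hf' i).add (hg' i)
  smul_mem' := by
    rintro c f ⟨hf, hf'⟩
    refine ⟨contDiff_const.smul hf, fun i => ?_⟩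
    have : iteratedDeriv i (c • f) = c • iteratedDeriv i f := by
      funext x
      exact iteratedDeriv_const_smul (hf.contDiffAt.of_le (by exact_mod_cast le_top)) c
    rw [this]
    exact (hf' i).smul c

/-- The space `D_{L^1}`. It is a type of its own, so that it carries the topology given by the
norms below and not the topology of pointwise convergence. -/
def DL1 : Type := DL1Submodule

namespace DL1

instance : AddCommGroup DL1 := inferInstanceAs (AddCommGroup DL1Submodule)

instance : Module ℂ DL1 := inferInstanceAs (Module ℂ DL1Submodule)

instance : CoeFun DL1 (fun _ => ℝ → ℂ) := ⟨fun φ => φ.1⟩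

theorem ext {φ ψ : DL1} (h : ∀ x, φ x = ψ x) : φ = ψ := Subtype.ext (funext h)

theorem contDiff (φ : DL1) : ContDiff ℝ ∞ (φ : ℝ → ℂ) := φ.2.1

theorem integrable (φ : DL1) (i : ℕ) : Integrable (iteratedDeriv i (φ : ℝ → ℂ)) := φ.2.2 i

theorem coe_add (φ ψ : DL1) : ((φ + ψ : DL1) : ℝ → ℂ) = (φ : ℝ → ℂ) + (ψ : ℝ → ℂ) := rfl

theorem coe_smul (c : ℂ) (φ : DL1) : ((c • φ : DL1) : ℝ → ℂ) = c • (φ : ℝ → ℂ) := rfl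

theorem iteratedDeriv_add' (i : ℕ) (φ ψ : DL1) :
    iteratedDeriv i ((φ + ψ : DL1) : ℝ → ℂ) =
      iteratedDeriv i (φ : ℝ → ℂ) + iteratedDeriv i (ψ : ℝ → ℂ) := by
  funext x
  exact iteratedDeriv_add (φ.contDiff.contDiffAt.of_le (by exact_mod_cast le_top))
    (ψ.contDiff.contDiffAt.of_le (by exact_mod_cast le_top))

theorem iteratedDeriv_smul' (i : ℕ) (c : ℂ) (φ : DL1) :
    iteratedDeriv i ((c • φ : DL1) : ℝ → ℂ) = c • iteratedDeriv i (φ : ℝ → ℂ) := by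
  funext x
  exact iteratedDeriv_const_smul (φ.contDiff.contDiffAt.of_le (by exact_mod_cast le_top)) c

/-- The norm `|φ|_{m,1} = ∑_{i ≤ m} ‖φ^{(i)}‖_{L^1}`. -/
def seminorm (m : ℕ) : Seminorm ℂ DL1 :=
  Seminorm.of (fun φ => ∑ i ∈ Finset.range (m + 1), ∫ x, ‖iteratedDeriv i (φ : ℝ → ℂ) x‖)
    (fun φ ψ => by
      rw [← Finset.sum_add_distrib]
      refine Finset.sum_le_sum fun i _ => ?_
      rw [← integral_add (φ.integrable i).norm (ψ.integrable i).norm]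
      refine integral_mono ((φ + ψ).integrable i).norm
        ((φ.integrable i).norm.add (ψ.integrable i).norm) fun x => ?_
      simp only [iteratedDeriv_add', Pi.add_apply]
      exact norm_add_le _ _)
    (fun c φ => by
      simp only [iteratedDeriv_smul', Pi.smul_apply, norm_smul, integral_const_mul,
        Finset.mul_sum])

/-- The family of norms defining the topology of `D_{L^1}`. -/
def seminormFamily : SeminormFamily ℂ DL1 ℕ := seminorm

/-- The topology of `D_{L^1}` is the one defined by the norms `|·|_{m,1}`. -/
instance : TopologicalSpace DL1 := seminormFamily.moduleFilterBasis.topology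

theorem withSeminorms : WithSeminorms seminormFamily := ⟨rfl⟩

instance : IsTopologicalAddGroup DL1 := withSeminorms.topologicalAddGroup

instance : ContinuousSMul ℂ DL1 := withSeminorms.continuousSMul

theorem seminorm_apply (m : ℕ) (φ : DL1) :
    seminorm m φ = ∑ i ∈ Finset.range (m + 1), ∫ x, ‖iteratedDeriv i (φ : ℝ → ℂ) x‖ := rfl

/-- Differentiation `φ ↦ φ'` as a linear map of `D_{L^1}`. -/
def derivLinear : DL1 →ₗ[ℂ] DL1 where
  toFun φ := ⟨deriv (φ : ℝ → ℂ), by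
    refine ⟨(contDiff_infty_iff_deriv.1 φ.contDiff).2, fun i => ?_⟩
    rw [← iteratedDeriv_succ']
    exact φ.integrable (i + 1)⟩
  map_add' φ ψ := by
    refine ext fun x => ?_
    have hφ := (φ.contDiff.differentiable (by simp)).differentiableAt (x := x)
    have hψ := (ψ.contDiff.differentiable (by simp)).differentiableAt (x := x)
    exact deriv_add hφ hψ
  map_smul' c φ := by
    refine ext fun x => ?_
    have hφ := (φ.contDiff.differentiable (by simp)).differentiableAt (x := x)
    exact deriv_const_smul c hφ

/-- Differentiation `φ ↦ φ'` as a continuous linear map of `D_{L^1}`. -/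
def derivCLM : DL1 →L[ℂ] DL1 where
  toLinearMap := derivLinear
  cont := by
    refine withSeminorms.continuous_of_isBounded withSeminorms (derivLinear)
      (Seminorm.IsBounded.of_real (σ₁₂ := RingHom.id ℂ) ?_)
    intro m
    refine ⟨{m + 1}, 1, fun φ => ?_⟩
    rw [Finset.sup_singleton, one_mul]
    change seminorm m _ ≤ seminorm (m + 1) φ
    rw [seminorm_apply, seminorm_apply, Finset.sum_range_succ' _ (m + 1)]
    refine le_add_of_le_of_nonneg (Finset.sum_le_sum fun i _ => ?_)
      (integral_nonneg fun x => norm_nonneg _)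
    rw [iteratedDeriv_succ']
    exact le_rfl

/-- The translation `φ ↦ τ_h φ = φ(· + h)` as a linear map of `D_{L^1}`. -/
def translateLinear (h : ℝ) : DL1 →ₗ[ℂ] DL1 where
  toFun φ := ⟨fun x => φ (x + h), by
    refine ⟨φ.contDiff.comp (contDiff_id.add contDiff_const), fun i => ?_⟩
    rw [iteratedDeriv_comp_add_const]
    exact (φ.integrable i).comp_add_right h⟩
  map_add' φ ψ := ext fun _ => rfl
  map_smul' c φ := ext fun _ => rfl

/-- The translation `φ ↦ τ_h φ = φ(· + h)` as a continuous linear map of `D_{L^1}`. -/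
def translateCLM (h : ℝ) : DL1 →L[ℂ] DL1 where
  toLinearMap := translateLinear h
  cont := by
    refine withSeminorms.continuous_of_isBounded withSeminorms (translateLinear h)
      (Seminorm.IsBounded.of_real (σ₁₂ := RingHom.id ℂ) ?_)
    intro m
    refine ⟨{m}, 1, fun φ => ?_⟩
    rw [Finset.sup_singleton, one_mul]
    change seminorm m _ ≤ seminorm m φ
    rw [seminorm_apply, seminorm_apply]
    refine Finset.sum_le_sum fun i _ => le_of_eq ?_
    change ∫ x, ‖iteratedDeriv i (fun y => φ (y + h)) x‖ = _
    rw [iteratedDeriv_comp_add_const]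
    exact integral_add_right_eq_self (fun x => ‖iteratedDeriv i (φ : ℝ → ℂ) x‖) h

@[simp] theorem derivCLM_apply (φ : DL1) (x : ℝ) : derivCLM φ x = deriv (φ : ℝ → ℂ) x := rfl

@[simp] theorem translateCLM_apply (h : ℝ) (φ : DL1) (x : ℝ) :
    translateCLM h φ x = φ (x + h) := rfl

/-- A test function `φ ∈ D` gives the element `φ̌ : y ↦ φ (-y)` of `D_{L^1}`. -/
def reflect (φ : 𝓓((⊤ : TopologicalSpace.Opens ℝ), ℂ)) : DL1 :=
  ⟨fun y => φ (-y), by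
    have hc : ContDiff ℝ ∞ (fun y : ℝ => φ (-y)) := φ.contDiff.comp contDiff_neg
    have hs : HasCompactSupport (fun y : ℝ => φ (-y)) :=
      φ.hasCompactSupport.comp_homeomorph (Homeomorph.neg ℝ)
    refine ⟨hc, fun i => ?_⟩
    have hci : Continuous (iteratedDeriv i (fun y : ℝ => φ (-y))) :=
      hc.continuous_iteratedDeriv i (by exact_mod_cast le_top)
    refine hci.integrable_of_hasCompactSupport ?_
    clear hc hci
    induction i with
    | zero => simpa using hs
    | succ n ih =>
      rw [iteratedDeriv_succ]
      exact ih.deriv⟩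

@[simp] theorem reflect_apply (φ : 𝓓((⊤ : TopologicalSpace.Opens ℝ), ℂ)) (y : ℝ) :
    reflect φ y = φ (-y) := rfl

end DL1

/-! ### Bounded distributions -/

/-- The space `D'_{L^∞}` of bounded distributions: the topological dual of `D_{L^1}`. -/
abbrev BoundedDistribution : Type := DL1 →L[ℂ] ℂ

/-- The derivative of a distribution, `⟨T', φ⟩ = -⟨T, φ'⟩`. -/
def BoundedDistribution.deriv (T : BoundedDistribution) : BoundedDistribution :=
  -(T.comp DL1.derivCLM)

/-- The translate of a distribution, `⟨τ_h T, φ⟩ = ⟨T, τ_{-h} φ⟩`. -/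
def BoundedDistribution.translate (h : ℝ) (T : BoundedDistribution) : BoundedDistribution :=
  T.comp (DL1.translateCLM (-h))

/-- The convolution with a test function, `(T ∗ φ)(x) = ⟨T, τ_{-x} φ̌⟩ = ⟨T, φ(x - ·)⟩`. -/
def BoundedDistribution.conv (T : BoundedDistribution)
    (φ : 𝓓((⊤ : TopologicalSpace.Opens ℝ), ℂ)) (x : ℝ) : ℂ :=
  T (DL1.translateCLM (-x) (DL1.reflect φ))

/-- The class `B'_aa` of almost automorphic distributions: the bounded distributions `T` with
`T ∗ φ` almost automorphic for every test function `φ`. -/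
def IsAlmostAutomorphicDistribution (T : BoundedDistribution) : Prop :=
  ∀ φ : 𝓓((⊤ : TopologicalSpace.Opens ℝ), ℂ), IsAlmostAutomorphic (T.conv φ)

/-- The operator `∑_{i ≤ p} ∑_{j ≤ q} a_{ij} (d/dx)^i τ_{h_j}` acting on distributions. -/
def opDist {p q : ℕ} (a : Fin (p + 1) → Fin (q + 1) → ℂ) (h : Fin (q + 1) → ℝ)
    (T : BoundedDistribution) : BoundedDistribution :=
  ∑ i : Fin (p + 1), ∑ j : Fin (q + 1),
    a i j • (BoundedDistribution.deriv^[(i : ℕ)] (BoundedDistribution.translate (h j) T))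

end AlmostAutomorphy

end

open AlmostAutomorphy

/-! On the Fourier side `L_h` is multiplication by `symbol a h`, the restriction to `ℝ` of an entire
function. The hypothesis on the homogeneous equation is needed only to exclude that this function
vanishes identically: otherwise every Schwartz function would solve `L_h f = 0`, whereas a nonzero
function tending to `0` at infinity is not almost automorphic (`exists_symbol_ne_zero`).

A nonzero analytic symbol has zeros of finite order, so near each `c` it equals `(ξ - c)^n g(ξ)`
with `g` analytic and nonvanishing. If `m` is a test function supported near `c`, dividing by `g`
writes `(d/dx - 2πic)^n 𝓕⁻ m` as `L_h k` with `k` Schwartz. Hence `T ∗ (d/dx - 2πic)^n 𝓕⁻ m = (L_h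
T) ∗ k = S ∗ k` is almost automorphic. The operator `d/dx - 2πic` is then removed `n` times by a
Bohr type theorem: a bounded `F` with `F' - 2πicF` almost automorphic is almost automorphic
(`IsAlmostAutomorphic.of_hasDerivAt_add`).

A partition of unity covers all compactly supported `m`. Since such `𝓕⁻ m` are dense in the Schwartz
space, and `k ↦ T ∗ k` is continuous from there to the sup norm, closure under uniform limits gives
every `T ∗ k`. -/

noncomputable section

namespace AlmostAutomorphy

/-! ### Almost automorphic functions -/

/-- The translates of `f` along `s` converge pointwise to a function whose translates along `-s`
converge back to `f`. -/
def TranslatesReturn (f : ℝ → ℂ) (s : ℕ → ℝ) : Prop :=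
  ∃ g : ℝ → ℂ, (∀ x, Tendsto (fun n => f (x + s n)) atTop (𝓝 (g x))) ∧
    (∀ x, Tendsto (fun n => g (x - s n)) atTop (𝓝 (f x)))

/-- Divergence of `l` suffices; the diagonal extraction uses this without checking monotonicity. -/
theorem TranslatesReturn.comp {f : ℝ → ℂ} {s : ℕ → ℝ} (h : TranslatesReturn f s) {l : ℕ → ℕ}
    (hl : Tendsto l atTop atTop) : TranslatesReturn f (s ∘ l) := by
  obtain ⟨g, h1, h2⟩ := h
  exact ⟨g, fun x => (h1 x).comp hl, fun x => (h2 x).comp hl⟩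

theorem TranslatesReturn.congr {f : ℝ → ℂ} {s t : ℕ → ℝ} (h : TranslatesReturn f s)
    (hst : s =ᶠ[atTop] t) : TranslatesReturn f t := by
  obtain ⟨g, h1, h2⟩ := h
  exact ⟨g, fun x => (h1 x).congr' (hst.mono fun n hn => by rw [hn]),
    fun x => (h2 x).congr' (hst.mono fun n hn => by rw [hn])⟩

theorem IsAlmostAutomorphic.exists_translatesReturn {f : ℝ → ℂ} (hf : IsAlmostAutomorphic f)
    (s : ℕ → ℝ) : ∃ k : ℕ → ℕ, StrictMono k ∧ TranslatesReturn f (s ∘ k) :=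
  hf.2 s

theorem isAlmostAutomorphic_zero : IsAlmostAutomorphic (fun _ => 0) :=
  ⟨continuous_const, fun _ => ⟨id, strictMono_id, fun _ => 0, fun _ => tendsto_const_nhds,
    fun _ => tendsto_const_nhds⟩⟩

theorem IsAlmostAutomorphic.add {f g : ℝ → ℂ} (hf : IsAlmostAutomorphic f)
    (hg : IsAlmostAutomorphic g) : IsAlmostAutomorphic (fun x => f x + g x) := by
  refine ⟨hf.1.add hg.1, fun s => ?_⟩
  obtain ⟨k, hk, h1⟩ := hf.exists_translatesReturn s
  obtain ⟨l, hl, G, hG, hG'⟩ := hg.exists_translatesReturn (s ∘ k)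
  obtain ⟨F, hF, hF'⟩ := h1.comp hl.tendsto_atTop
  exact ⟨k ∘ l, hk.comp hl, fun x => F x + G x, fun x => (hF x).add (hG x),
    fun x => (hF' x).add (hG' x)⟩

theorem isAlmostAutomorphic_sum {ι : Type*} (t : Finset ι) {f : ι → ℝ → ℂ}
    (hf : ∀ i ∈ t, IsAlmostAutomorphic (f i)) :
    IsAlmostAutomorphic (fun x => ∑ i ∈ t, f i x) := by
  classical
  induction t using Finset.induction_on with
  | empty => simpa using isAlmostAutomorphic_zero
  | insert i t hi ih =>
    simp only [Finset.sum_insert hi]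
    exact (hf i (Finset.mem_insert_self i t)).add
      (ih fun j hj => hf j (Finset.mem_insert_of_mem hj))

/-- Multiplication by a character preserves almost automorphy. -/
theorem IsAlmostAutomorphic.mul_exp {f : ℝ → ℂ} (hf : IsAlmostAutomorphic f) (c : ℝ) :
    IsAlmostAutomorphic (fun x => f x * Complex.exp (c * x * Complex.I)) := by
  refine ⟨hf.1.mul (by fun_prop), fun s => ?_⟩
  obtain ⟨k, hk, h1⟩ := hf.exists_translatesReturn s
  have hn : ∀ t : ℝ, ‖Complex.exp (c * t * Complex.I)‖ = 1 := fun t => by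
    rw [← Complex.ofReal_mul, Complex.norm_exp_ofReal_mul_I]
  -- The phases accumulate at some `w` of modulus one; being invertible, `w` can be undone on the
  -- way back.
  obtain ⟨w, -, l, hl, hw⟩ := tendsto_subseq_of_bounded (s := Metric.closedBall (0 : ℂ) 1)
    Metric.isBounded_closedBall (x := fun n => Complex.exp (c * (s (k n) : ℝ) * Complex.I))
    (fun n => by simp [hn])
  obtain ⟨F, hF, hF'⟩ := h1.comp hl.tendsto_atTop
  have hw0 : w ≠ 0 := by
    have := tendsto_nhds_unique hw.norm (by simp [hn] :
      Tendsto (fun n => ‖((fun n => Complex.exp (c * (s (k n) : ℝ) * Complex.I)) ∘ l) n‖)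
        atTop (𝓝 1))
    intro h
    simp [h] at this
  refine ⟨k ∘ l, hk.comp hl, fun x => F x * (Complex.exp (c * x * Complex.I) * w),
    fun x => ?_, fun x => ?_⟩
  · refine ((hF x).mul (hw.const_mul (Complex.exp (c * x * Complex.I)))).congr fun n => ?_
    simp only [Function.comp_apply]
    rw [← Complex.exp_add]
    congr 2
    push_cast
    ring
  · have h3 := (hF' x).mul ((hw.inv₀ hw0).const_mul (Complex.exp (c * x * Complex.I) * w))
    rw [mul_assoc _ w, mul_inv_cancel₀ hw0, mul_one] at h3
    refine h3.congr fun n => ?_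
    simp only [Function.comp_apply]
    rw [← Complex.exp_neg, mul_right_comm, ← Complex.exp_add]
    congr 3
    push_cast
    ring

theorem IsAlmostAutomorphic.bounded {f : ℝ → ℂ} (hf : IsAlmostAutomorphic f) :
    ∃ C, ∀ x, ‖f x‖ ≤ C := by
  by_contra! h
  choose s hs using fun n : ℕ => h n
  obtain ⟨k, hk, g, hg, -⟩ := hf.exists_translatesReturn s
  have h1 := (hg 0).norm
  refine not_tendsto_nhds_of_tendsto_atTop ?_ _ h1
  refine tendsto_atTop_mono (fun n => ?_) (tendsto_natCast_atTop_atTop.comp hk.tendsto_atTop)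
  simpa using (hs (k n)).le

/-- Diagonal extraction for countably many almost automorphic functions. -/
theorem exists_strictMono_forall_translatesReturn {F : ℕ → ℝ → ℂ}
    (hF : ∀ n, IsAlmostAutomorphic (F n)) (s : ℕ → ℝ) :
    ∃ k : ℕ → ℕ, StrictMono k ∧ ∀ n, TranslatesReturn (F n) (s ∘ k) := by
  choose K hK hKret using fun n => (hF n).exists_translatesReturn
  let φ : ℕ → ℕ → ℕ := fun n => Nat.rec (K 0 s) (fun n p => p ∘ K (n + 1) (s ∘ p)) n
  have hφs : ∀ n, φ (n + 1) = φ n ∘ K (n + 1) (s ∘ φ n) := fun n => rfl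
  have hφm : ∀ n, StrictMono (φ n) := fun n => by
    induction n with
    | zero => exact hK 0 s
    | succ n ih => rw [hφs]; exact ih.comp (hK _ _)
  have hφr : ∀ n, TranslatesReturn (F n) (s ∘ φ n) := fun n => by
    cases n with
    | zero => exact hKret 0 s
    | succ n => rw [hφs]; exact hKret (n + 1) (s ∘ φ n)
  -- The extractions are nested, so from index `m` on the diagonal factors through `φ m`.
  have hsub : ∀ m i, ∃ ψ : ℕ → ℕ, StrictMono ψ ∧ φ (m + i) = φ m ∘ ψ := fun m i => by
    induction i with
    | zero => exact ⟨id, strictMono_id, rfl⟩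
    | succ i ih =>
      obtain ⟨ψ, h1, h2⟩ := ih
      exact ⟨ψ ∘ K (m + i + 1) (s ∘ φ (m + i)), h1.comp (hK _ _), by
        rw [← add_assoc, hφs, h2, Function.comp_assoc]⟩
  choose ψ hψ hψφ using hsub
  refine ⟨fun n => φ n n, strictMono_nat_of_lt_succ fun n => ?_, fun m => ?_⟩
  · change φ n n < φ (n + 1) (n + 1)
    rw [hφs]
    exact hφm n (lt_of_lt_of_le n.lt_succ_self ((hK _ _).id_le (n + 1)))
  · have hl : Tendsto (fun n => ψ m (n - m) n) atTop atTop :=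
      tendsto_atTop_mono (fun n => (hψ m (n - m)).id_le n) tendsto_id
    refine ((hφr m).comp hl).congr ?_
    filter_upwards [eventually_ge_atTop m] with n hn
    have := hψφ m (n - m)
    rw [Nat.add_sub_cancel' hn] at this
    simp [this]

/-- A uniform limit of almost automorphic functions is almost automorphic. -/
theorem isAlmostAutomorphic_of_forall_exists_norm_sub_le {f : ℝ → ℂ}
    (h : ∀ ε > 0, ∃ g, IsAlmostAutomorphic g ∧ ∀ x, ‖f x - g x‖ ≤ ε) :
    IsAlmostAutomorphic f := by
  choose F hF hFf using fun n : ℕ => h (1 / ((n : ℝ) + 1)) (by positivity)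
  have hlim := tendsto_one_div_add_atTop_nhds_zero_nat (𝕜 := ℝ)
  have hunif : TendstoUniformly F f atTop := by
    rw [Metric.tendstoUniformly_iff]
    intro ε hε
    filter_upwards [hlim.eventually_lt_const hε] with n hn x
    rw [dist_eq_norm]
    exact (hFf n x).trans_lt hn
  refine ⟨hunif.continuous (Frequently.of_forall fun n => (hF n).1), fun s => ?_⟩
  obtain ⟨k, hk, hret⟩ := exists_strictMono_forall_translatesReturn hF s
  choose G hG hG' using hret
  -- The limit functions inherit the uniform closeness of the `F n`, so they converge uniformly and
  -- the limits interchange in both directions.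
  have hGG : ∀ n m x, ‖G n x - G m x‖ ≤ 1 / ((n : ℝ) + 1) + 1 / ((m : ℝ) + 1) := by
    intro n m x
    refine le_of_tendsto ((hG n x).sub (hG m x)).norm (Eventually.of_forall fun i => ?_)
    set y := x + (s ∘ k) i
    calc ‖F n y - F m y‖ = ‖(f y - F m y) - (f y - F n y)‖ := by congr 1; ring
      _ ≤ ‖f y - F m y‖ + ‖f y - F n y‖ := norm_sub_le _ _
      _ ≤ _ := by linarith [hFf n y, hFf m y]
  have hcau : ∀ x, ∃ y, Tendsto (fun n => G n x) atTop (𝓝 y) := fun x => by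
    refine cauchySeq_tendsto_of_complete (Metric.cauchySeq_iff'.2 fun ε hε => ?_)
    obtain ⟨N, hN⟩ := (hlim.eventually_lt_const (half_pos hε)).exists_forall_of_atTop
    refine ⟨N, fun n hn => ?_⟩
    rw [dist_eq_norm]
    linarith [hGG n N x, hN n hn, hN N le_rfl]
  choose g hg using hcau
  have hGg : ∀ n x, ‖g x - G n x‖ ≤ 1 / ((n : ℝ) + 1) := by
    intro n x
    have h1 : Tendsto (fun m : ℕ => 1 / ((m : ℝ) + 1) + 1 / ((n : ℝ) + 1)) atTop
        (𝓝 (0 + 1 / ((n : ℝ) + 1))) := hlim.add_const _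
    rw [zero_add] at h1
    exact le_of_tendsto_of_tendsto' ((hg x).sub_const _).norm h1 fun m => hGG m n x
  have hunif' : TendstoUniformly G g atTop := by
    rw [Metric.tendstoUniformly_iff]
    intro ε hε
    filter_upwards [hlim.eventually_lt_const hε] with n hn x
    rw [dist_eq_norm]
    exact (hGg n x).trans_lt hn
  refine ⟨k, hk, g, fun x => ?_, fun x => ?_⟩
  · refine TendstoUniformlyOnFilter.tendsto_of_eventually_tendsto (p := atTop)
      (F := fun n i => F n (x + s (k i))) ?_ (Eventually.of_forall fun n => hG n x) (hg x)
    exact (hunif.comp fun i => x + s (k i)).tendstoUniformlyOnFilter.mono_right le_top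
  · refine TendstoUniformlyOnFilter.tendsto_of_eventually_tendsto (p := atTop)
      (F := fun n i => G n (x - s (k i))) ?_ (Eventually.of_forall fun n => hG' n x)
      (hunif.tendsto_at x)
    exact (hunif'.comp fun i => x - s (k i)).tendstoUniformlyOnFilter.mono_right le_top

/-- A bounded primitive of an almost automorphic function is almost automorphic. -/
theorem IsAlmostAutomorphic.of_hasDerivAt {F f : ℝ → ℂ} (hf : IsAlmostAutomorphic f)
    (hF : ∀ x, HasDerivAt F (f x) x) (hb : ∃ C, ∀ x, ‖F x‖ ≤ C) : IsAlmostAutomorphic F := by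
  refine ⟨continuous_iff_continuousAt.2 fun x => (hF x).continuousAt, fun s => ?_⟩
  obtain ⟨C, hC⟩ := hb
  obtain ⟨M, hM⟩ := hf.bounded
  have hfi : ∀ a x y : ℝ, IntervalIntegrable (fun t => f (t + a)) volume x y := fun a x y =>
    (hf.1.comp (by fun_prop)).intervalIntegrable x y
  have hFint : ∀ x a, F (x + a) = F a + ∫ t in (0 : ℝ)..x, f (t + a) := fun x a => by
    rw [intervalIntegral.integral_eq_sub_of_hasDerivAt (f := fun t => F (t + a))
      (fun t _ => (hF (t + a)).comp_add_const t a) (hfi _ _ _)]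
    simp
  obtain ⟨k, hk, h1⟩ := hf.exists_translatesReturn s
  obtain ⟨c, -, l, hl, hc⟩ := tendsto_subseq_of_bounded (s := Metric.closedBall (0 : ℂ) C)
    Metric.isBounded_closedBall (x := fun n => F (s (k n))) (fun n => by simpa using hC _)
  obtain ⟨g, hg, hg'⟩ := h1.comp hl.tendsto_atTop
  have hgM : ∀ x, ‖g x‖ ≤ M := fun x => le_of_tendsto (hg x).norm
    (Eventually.of_forall fun n => hM _)
  -- `g` may be discontinuous; bounded and measurable is enough for dominated convergence.
  have hgm : Measurable g := measurable_of_tendsto_metrizable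
    (f := fun n x => f (x + ((s ∘ k) ∘ l) n))
    (fun n => (hf.1.comp (by fun_prop)).measurable) (tendsto_pi_nhds.2 hg)
  have hgi : ∀ a x y : ℝ, IntervalIntegrable (fun t => g (t + a)) volume x y := fun a x y =>
    (intervalIntegrable_const (c := M)).mono_fun
      (hgm.comp (measurable_add_const a)).aestronglyMeasurable
      (Eventually.of_forall fun t => (hgM _).trans (le_abs_self M))
  let G : ℝ → ℂ := fun x => c + ∫ t in (0 : ℝ)..x, g t
  have hFG : ∀ x, Tendsto (fun n => F (x + ((s ∘ k) ∘ l) n)) atTop (𝓝 (G x)) := fun x => by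
    simp only [hFint x]
    refine hc.add (intervalIntegral.tendsto_integral_filter_of_dominated_convergence
      (fun _ => M) (Eventually.of_forall fun n => ?_) (Eventually.of_forall fun n =>
        Eventually.of_forall fun t _ => hM _) intervalIntegrable_const
      (Eventually.of_forall fun t _ => hg t))
    exact (hf.1.comp (by fun_prop)).aestronglyMeasurable
  have hGint : ∀ x a, G (x + a) = G a + ∫ t in (0 : ℝ)..x, g (t + a) := fun x a => by
    have hi : ∀ x y : ℝ, IntervalIntegrable g volume x y := fun x y => by simpa using hgi 0 x y
    simp only [G, intervalIntegral.integral_comp_add_right, zero_add]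
    rw [add_assoc, intervalIntegral.integral_add_adjacent_intervals (hi _ _) (hi _ _)]
  have hGmem : ∀ x, G x ∈ closure (Set.range F) := fun x =>
    mem_closure_of_tendsto (hFG x) (Eventually.of_forall fun n => Set.mem_range_self _)
  have hFb : Bornology.IsBounded (Set.range F) :=
    Metric.isBounded_closedBall.subset (s := Set.range F) (t := Metric.closedBall (0 : ℂ) C)
      (Set.range_subset_iff.2 fun x => by simpa using hC x)
  obtain ⟨c', -, l', hl', hc'⟩ := tendsto_subseq_of_bounded hFb.closure
    (x := fun n => G (-((s ∘ k) ∘ l) n)) (fun n => hGmem _)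
  -- Translating `G` back recovers `F` only up to a constant `d`, to be shown zero.
  let r : ℕ → ℝ := ((s ∘ k) ∘ l) ∘ l'
  let d : ℂ := c' - F 0
  have hGF : ∀ x, Tendsto (fun n => G (x - r n)) atTop (𝓝 (F x + d)) := fun x => by
    have hx : F x + d = c' + ∫ t in (0 : ℝ)..x, f t := by
      have := hFint x 0
      simp only [add_zero] at this
      rw [this]
      simp only [d]
      ring
    simp only [sub_eq_add_neg, hGint x]
    rw [hx]
    refine hc'.add (intervalIntegral.tendsto_integral_filter_of_dominated_convergence
      (fun _ => M) (Eventually.of_forall fun n => ?_) (Eventually.of_forall fun n =>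
        Eventually.of_forall fun t _ => hgM _) intervalIntegrable_const
      (Eventually.of_forall fun t _ => (hg' t).comp hl'.tendsto_atTop))
    exact (hgm.comp (measurable_add_const _)).aestronglyMeasurable
  -- The bounded set `closure (Set.range F)` is stable under adding `d`; iterating forces `d = 0`.
  have hshift : ∀ y ∈ closure (Set.range F), y + d ∈ closure (Set.range F) := by
    refine fun y hy => closure_minimal (s := Set.range F)
      (t := (fun y => y + d) ⁻¹' closure (Set.range F)) ?_
      (isClosed_closure.preimage (continuous_add_const d)) hy
    rintro _ ⟨x, rfl⟩
    exact isClosed_closure.mem_of_tendsto (hGF x) (Eventually.of_forall fun n => hGmem _)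
  have hnd : ∀ n : ℕ, F 0 + n * d ∈ closure (Set.range F) := fun n => by
    induction n with
    | zero => simpa using subset_closure (Set.mem_range_self 0)
    | succ n ih =>
      have := hshift _ ih
      rwa [add_assoc, ← add_one_mul, ← Nat.cast_succ] at this
  have hd : d = 0 := by
    by_contra hd
    obtain ⟨R, hR⟩ := hFb.closure.exists_norm_le
    obtain ⟨n, hn⟩ := exists_nat_gt ((R + C) / ‖d‖)
    rw [div_lt_iff₀ (norm_pos_iff.2 hd)] at hn
    have h2 : ‖(n : ℂ) * d‖ ≤ ‖F 0 + n * d‖ + ‖F 0‖ := by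
      simpa using norm_sub_le (F 0 + n * d) (F 0)
    rw [norm_mul, Complex.norm_natCast] at h2
    linarith [hR _ (hnd n), hC 0]
  refine ⟨k ∘ l ∘ l', hk.comp (hl.comp hl'), G, fun x => (hFG x).comp hl'.tendsto_atTop,
    fun x => ?_⟩
  have := hGF x
  rwa [hd, add_zero] at this

/-- Bounded solutions of `F' - i c F = f` with `f` almost automorphic are almost automorphic. -/
theorem IsAlmostAutomorphic.of_hasDerivAt_add {F f : ℝ → ℂ} (c : ℝ) (hf : IsAlmostAutomorphic f)
    (hF : ∀ x, HasDerivAt F (f x + c * Complex.I * F x) x) (hb : ∃ C, ∀ x, ‖F x‖ ≤ C) :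
    IsAlmostAutomorphic F := by
  obtain ⟨C, hC⟩ := hb
  -- Integrating factor: the product is a bounded primitive of `f` times a character.
  have h1 : IsAlmostAutomorphic (fun x => F x * Complex.exp ((-c : ℝ) * x * Complex.I)) := by
    refine (hf.mul_exp (-c)).of_hasDerivAt (fun x => ?_) ⟨C, fun x => ?_⟩
    · have h2 : HasDerivAt (fun x : ℝ => Complex.exp ((-c : ℝ) * x * Complex.I))
          (Complex.exp ((-c : ℝ) * x * Complex.I) * ((-c : ℝ) * 1 * Complex.I)) x :=
        ((Complex.ofRealCLM.hasDerivAt.const_mul _).mul_const _).cexp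
      refine ((hF x).mul h2).congr_deriv ?_
      push_cast
      ring
    · rw [norm_mul, ← Complex.ofReal_mul, Complex.norm_exp_ofReal_mul_I, mul_one]
      exact hC x
  have h2 := h1.mul_exp c
  convert h2 using 2 with x
  rw [mul_assoc, ← Complex.exp_add]
  simp

/-! ### First order Taylor remainders in `L^1` -/

theorem lintegral_enorm_intervalIntegral_le {K : ℝ → ℝ → ℂ}
    (hK : Continuous (Function.uncurry K)) {B : ENNReal}
    (hB : ∀ t ∈ Set.Ioc (0 : ℝ) 1, ∫⁻ x, ‖K t x‖ₑ ≤ B) :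
    ∫⁻ x, ‖∫ t in (0 : ℝ)..1, K t x‖ₑ ≤ B := by
  calc ∫⁻ x, ‖∫ t in (0 : ℝ)..1, K t x‖ₑ
      ≤ ∫⁻ x, ∫⁻ t in Set.Ioc (0 : ℝ) 1, ‖K t x‖ₑ := by
        refine lintegral_mono fun x => ?_
        rw [intervalIntegral.integral_of_le zero_le_one]
        exact enorm_integral_le_lintegral_enorm _
    _ = ∫⁻ t in Set.Ioc (0 : ℝ) 1, ∫⁻ x, ‖K t x‖ₑ := by
        refine lintegral_lintegral_swap (Continuous.aemeasurable ?_)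
        exact (hK.comp continuous_swap).enorm
    _ ≤ ∫⁻ _ in Set.Ioc (0 : ℝ) 1, B := setLIntegral_mono measurable_const hB
    _ = B := by simp

theorem sub_eq_smul_intervalIntegral_deriv {f : ℝ → ℂ} (hf : ContDiff ℝ 1 f) (x h : ℝ) :
    f (x + h) - f x = h • ∫ t in (0 : ℝ)..1, deriv f (x + t * h) := by
  rw [← intervalIntegral.integral_smul,
    intervalIntegral.integral_eq_sub_of_hasDerivAt (f := fun t => f (x + t * h))]
  · simp
  · intro t _
    have h1 : HasDerivAt (fun t : ℝ => x + t * h) h t := by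
      simpa using ((hasDerivAt_id t).mul_const h).const_add x
    exact ((hf.differentiable one_ne_zero).differentiableAt.hasDerivAt).scomp t h1
  · exact ((hf.continuous_deriv le_rfl).comp (by fun_prop)).const_smul h
      |>.intervalIntegrable _ _

theorem lintegral_enorm_translate_sub_le {f : ℝ → ℂ} (hf : ContDiff ℝ 1 f) (h : ℝ) :
    ∫⁻ x, ‖f (x + h) - f x‖ₑ ≤ ‖h‖ₑ * ∫⁻ x, ‖deriv f x‖ₑ := by
  simp only [sub_eq_smul_intervalIntegral_deriv hf, enorm_smul]
  rw [lintegral_const_mul' _ _ enorm_ne_top]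
  refine mul_le_mul' le_rfl ?_
  refine lintegral_enorm_intervalIntegral_le (K := fun t x => deriv f (x + t * h))
    ((hf.continuous_deriv le_rfl).comp (by fun_prop)) fun t _ => le_of_eq ?_
  exact lintegral_add_right_eq_self (fun x => ‖deriv f x‖ₑ) (t * h)

/-- The remainder is `h` times the mean over `t ∈ [0, 1]` of `f'(x + th) - f'(x)`; the first order
estimate for `f'` gives the second factor `h`. -/
theorem lintegral_enorm_taylor_le {f : ℝ → ℂ} (hf : ContDiff ℝ 2 f) (h : ℝ) :
    ∫⁻ x, ‖f (x + h) - f x - h • deriv f x‖ₑ ≤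
      ‖h‖ₑ * (‖h‖ₑ * ∫⁻ x, ‖deriv (deriv f) x‖ₑ) := by
  have hf1 : ContDiff ℝ 1 f := hf.of_le one_le_two
  have hf' : ContDiff ℝ 1 (deriv f) := (contDiff_succ_iff_deriv (n := 1).1 hf).2.2
  have hc : Continuous (deriv f) := hf'.continuous
  have key : ∀ x, f (x + h) - f x - h • deriv f x =
      h • ∫ t in (0 : ℝ)..1, (deriv f (x + t * h) - deriv f x) := fun x => by
    have hi : IntervalIntegrable (fun t => deriv f (x + t * h)) volume 0 1 :=
      (hc.comp (by fun_prop)).intervalIntegrable _ _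
    rw [intervalIntegral.integral_sub hi intervalIntegrable_const, smul_sub,
      ← sub_eq_smul_intervalIntegral_deriv hf1]
    simp
  simp only [key, enorm_smul]
  rw [lintegral_const_mul' _ _ enorm_ne_top]
  refine mul_le_mul' le_rfl ?_
  refine lintegral_enorm_intervalIntegral_le (K := fun t x => deriv f (x + t * h) - deriv f x)
    ((hc.comp (by fun_prop)).sub (hc.comp (by fun_prop))) fun t ht => ?_
  refine (lintegral_enorm_translate_sub_le hf' (t * h)).trans ?_
  gcongr
  rw [enorm_mul]
  refine mul_le_of_le_one_left' ?_
  rw [Real.enorm_eq_ofReal ht.1.le]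
  exact ENNReal.ofReal_le_one.2 ht.2

theorem integral_norm_taylor_le {f : ℝ → ℂ} (hf : ContDiff ℝ 2 f)
    (hf2 : Integrable (deriv (deriv f))) (h : ℝ) :
    ∫ x, ‖f (x + h) - f x - h • deriv f x‖ ≤ h ^ 2 * ∫ x, ‖deriv (deriv f) x‖ := by
  have hc : Continuous fun x => f (x + h) - f x - h • deriv f x :=
    ((hf.continuous.comp (by fun_prop)).sub hf.continuous).sub
      ((hf.continuous_deriv one_le_two).const_smul h)
  rw [integral_norm_eq_lintegral_enorm hc.aestronglyMeasurable,
    integral_norm_eq_lintegral_enorm hf2.1]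
  have h1 : (‖h‖ₑ * (‖h‖ₑ * ∫⁻ x, ‖deriv (deriv f) x‖ₑ)).toReal =
      h ^ 2 * (∫⁻ x, ‖deriv (deriv f) x‖ₑ).toReal := by
    simp only [ENNReal.toReal_mul, toReal_enorm, Real.norm_eq_abs]
    rw [← mul_assoc, abs_mul_abs_self, sq]
  rw [← h1]
  refine ENNReal.toReal_mono ?_ (lintegral_enorm_taylor_le hf h)
  exact ENNReal.mul_ne_top enorm_ne_top (ENNReal.mul_ne_top enorm_ne_top hf2.2.ne)

/-! ### Convolution with elements of `D_{L^1}` -/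

namespace DL1

theorem iteratedDeriv_eq (i : ℕ) (φ : DL1) :
    iteratedDeriv i (φ : ℝ → ℂ) = (derivCLM^[i] φ : DL1) := by
  induction i generalizing φ with
  | zero => simp
  | succ n ih => rw [iteratedDeriv_succ', Function.iterate_succ_apply, ← ih]; rfl

theorem seminorm_mono {m n : ℕ} (h : m ≤ n) : seminorm m ≤ seminorm n := fun φ => by
  rw [seminorm_apply, seminorm_apply]
  exact Finset.sum_le_sum_of_subset_of_nonneg (Finset.range_mono (by omega))
    fun i _ _ => integral_nonneg fun x => norm_nonneg _

theorem seminorm_translateCLM (m : ℕ) (h : ℝ) (φ : DL1) :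
    seminorm m (translateCLM h φ) = seminorm m φ := by
  rw [seminorm_apply, seminorm_apply]
  refine Finset.sum_congr rfl fun i _ => ?_
  change ∫ x, ‖iteratedDeriv i (fun y => φ (y + h)) x‖ = _
  rw [iteratedDeriv_comp_add_const]
  exact integral_add_right_eq_self (fun x => ‖iteratedDeriv i (φ : ℝ → ℂ) x‖) h

theorem derivCLM_translateCLM (h : ℝ) (φ : DL1) :
    derivCLM (translateCLM h φ) = translateCLM h (derivCLM φ) :=
  ext fun x => deriv_comp_add_const (φ : ℝ → ℂ) h x

theorem translateCLM_translateCLM (h k : ℝ) (φ : DL1) :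
    translateCLM h (translateCLM k φ) = translateCLM (h + k) φ :=
  ext fun x => by simp [add_assoc]

/-- Differentiation commutes with translation, so each derivative of the remainder is the remainder
of a derivative. -/
theorem seminorm_taylor_le (m : ℕ) (φ : DL1) :
    ∃ K : ℝ, ∀ h : ℝ, seminorm m (translateCLM h φ - φ - (h : ℂ) • derivCLM φ) ≤ K * h ^ 2 := by
  refine ⟨∑ i ∈ Finset.range (m + 1), ∫ x, ‖iteratedDeriv (i + 2) (φ : ℝ → ℂ) x‖, fun h => ?_⟩
  rw [seminorm_apply, Finset.sum_mul]
  refine Finset.sum_le_sum fun i hi => ?_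
  clear hi
  have h1 : (derivCLM^[i] (translateCLM h φ - φ - (h : ℂ) • derivCLM φ) : DL1) =
      translateCLM h (derivCLM^[i] φ) - derivCLM^[i] φ - (h : ℂ) • derivCLM (derivCLM^[i] φ) := by
    induction i with
    | zero => rfl
    | succ n ih => simp only [Function.iterate_succ_apply', ih, map_sub, map_smul,
        derivCLM_translateCLM]
  have h2 := integral_norm_taylor_le (f := (derivCLM^[i] φ : DL1))
    (contDiff_infty.1 (contDiff _) 2) ?_ h
  · rw [mul_comm]
    rw [iteratedDeriv_eq, iteratedDeriv_eq, h1, Function.iterate_succ_apply',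
      Function.iterate_succ_apply']
    refine le_trans (le_of_eq (integral_congr_ae (Eventually.of_forall fun x => ?_))) h2
    change ‖(derivCLM^[i] φ : DL1) (x + h) - (derivCLM^[i] φ : DL1) x -
      (h : ℂ) * deriv (derivCLM^[i] φ : DL1) x‖ = _
    rw [Complex.real_smul]
  · have := (derivCLM^[i] φ : DL1).integrable 2
    rwa [iteratedDeriv_succ, iteratedDeriv_one] at this

/-- The reflection `φ̌ : y ↦ φ (-y)` of an element of `D_{L^1}`. -/
def flip (φ : DL1) : DL1 :=
  ⟨fun y => φ (-y), φ.contDiff.comp contDiff_neg, fun i => by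
    have : iteratedDeriv i (fun y => φ (-y)) =
        fun y => (-1 : ℝ) ^ i • iteratedDeriv i (φ : ℝ → ℂ) (-y) :=
      funext fun y => iteratedDeriv_comp_neg i (φ : ℝ → ℂ) y
    rw [this]
    exact (φ.integrable i).comp_neg.smul ((-1 : ℝ) ^ i)⟩

theorem flip_add (φ ψ : DL1) : flip (φ + ψ) = flip φ + flip ψ := rfl

theorem flip_smul (c : ℂ) (φ : DL1) : flip (c • φ) = c • flip φ := rfl

theorem flip_derivCLM (φ : DL1) : flip (derivCLM φ) = -derivCLM (flip φ) :=
  ext fun x => by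
    change deriv (φ : ℝ → ℂ) (-x) = -deriv (fun y => (φ : ℝ → ℂ) (-y)) x
    rw [deriv_comp_neg, neg_neg]

theorem flip_translateCLM (h : ℝ) (φ : DL1) :
    flip (translateCLM h φ) = translateCLM (-h) (flip φ) :=
  ext fun x => congrArg (φ : ℝ → ℂ) (show -x + h = -(x + -h) by ring)

theorem seminorm_flip (m : ℕ) (φ : DL1) : seminorm m (flip φ) = seminorm m φ := by
  rw [seminorm_apply, seminorm_apply]
  refine Finset.sum_congr rfl fun i _ => ?_
  have : ∀ x, ‖iteratedDeriv i (flip φ : ℝ → ℂ) x‖ = ‖iteratedDeriv i (φ : ℝ → ℂ) (-x)‖ :=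
    fun x => by
      rw [show iteratedDeriv i (flip φ : ℝ → ℂ) x = _ from
        iteratedDeriv_comp_neg i (φ : ℝ → ℂ) x, norm_smul]
      simp
  simp only [this]
  exact integral_neg_eq_self (fun x => ‖iteratedDeriv i (φ : ℝ → ℂ) x‖) volume

end DL1

/-! ### Convolutions of bounded distributions: uniform bounds, derivatives, action of the operator.
-/

namespace BoundedDistribution

open DL1

/-- The convolution `(T ∗ ψ)(x) = ⟨T, ψ(x - ·)⟩` with an element of `D_{L^1}`. -/
def convDL1 (T : BoundedDistribution) (ψ : DL1) (x : ℝ) : ℂ :=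
  T (translateCLM (-x) (flip ψ))

theorem convDL1_add (T : BoundedDistribution) (φ ψ : DL1) (x : ℝ) :
    T.convDL1 (φ + ψ) x = T.convDL1 φ x + T.convDL1 ψ x := by
  simp only [convDL1, flip_add, map_add]

theorem convDL1_smul (T : BoundedDistribution) (c : ℂ) (ψ : DL1) (x : ℝ) :
    T.convDL1 (c • ψ) x = c * T.convDL1 ψ x := by
  simp only [convDL1, flip_smul, map_smul, smul_eq_mul]

theorem convDL1_sum (T : BoundedDistribution) {ι : Type*} (t : Finset ι) (ψ : ι → DL1) (x : ℝ) :
    T.convDL1 (∑ i ∈ t, ψ i) x = ∑ i ∈ t, T.convDL1 (ψ i) x :=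
  map_sum (AddMonoidHom.mk' (fun ψ => T.convDL1 ψ x) fun φ ψ => T.convDL1_add φ ψ x) ψ t

theorem exists_norm_le_seminorm (T : BoundedDistribution) :
    ∃ (m : ℕ) (C : ℝ), 0 < C ∧ ∀ φ : DL1, ‖T φ‖ ≤ C * seminorm m φ := by
  obtain ⟨s, C, -, h⟩ := Seminorm.bound_of_continuous withSeminorms
    ((normSeminorm ℂ ℂ).comp T.toLinearMap) (continuous_norm.comp T.continuous)
  -- The norms increase with `m`, so the largest index dominates; `C + 1` makes the constant
  -- positive.
  refine ⟨s.sup id, C + 1, by positivity, fun φ => (h φ).trans ?_⟩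
  have h1 : s.sup seminormFamily ≤ seminorm (s.sup id) :=
    Finset.sup_le fun i hi => seminorm_mono (Finset.le_sup (f := id) hi)
  calc (C : ℝ) * s.sup seminormFamily φ ≤ C * seminorm (s.sup id) φ := by
        gcongr
        exact h1 φ
    _ ≤ _ := by
        gcongr
        linarith

/-- Translations and reflection are isometric for the norms, hence a bound uniform in `x`. -/
theorem norm_convDL1_le {T : BoundedDistribution} {m : ℕ} {C : ℝ}
    (h : ∀ φ : DL1, ‖T φ‖ ≤ C * seminorm m φ) (ψ : DL1) (x : ℝ) :
    ‖T.convDL1 ψ x‖ ≤ C * seminorm m ψ := by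
  refine (h _).trans_eq ?_
  rw [seminorm_translateCLM, seminorm_flip]

theorem exists_norm_convDL1_le (T : BoundedDistribution) (ψ : DL1) :
    ∃ C, ∀ x, ‖T.convDL1 ψ x‖ ≤ C := by
  obtain ⟨m, C, -, h⟩ := T.exists_norm_le_seminorm
  exact ⟨_, norm_convDL1_le h ψ⟩

/-- Continuity of `T` turns the Taylor bound in `D_{L^1}` into an `O(h ^ 2)` error. -/
theorem hasDerivAt_convDL1 (T : BoundedDistribution) (ψ : DL1) (x : ℝ) :
    HasDerivAt (T.convDL1 ψ) (T.convDL1 (derivCLM ψ) x) x := by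
  obtain ⟨m, C, hC, hT⟩ := T.exists_norm_le_seminorm
  obtain ⟨K, hK⟩ := seminorm_taylor_le m (translateCLM (-x) (flip ψ))
  rw [hasDerivAt_iff_isLittleO_nhds_zero]
  refine Asymptotics.IsBigO.trans_isLittleO (g := fun h : ℝ => h ^ 2) ?_
    (by simpa using Asymptotics.isLittleO_pow_pow (𝕜 := ℝ) one_lt_two)
  refine Asymptotics.IsBigO.of_bound (C * K) (Eventually.of_forall fun h => ?_)
  have h1 : T.convDL1 ψ (x + h) - T.convDL1 ψ x - h • T.convDL1 (derivCLM ψ) x =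
      T (translateCLM (-h) (translateCLM (-x) (flip ψ)) - translateCLM (-x) (flip ψ) -
        ((-h : ℝ) : ℂ) • derivCLM (translateCLM (-x) (flip ψ))) := by
    simp only [convDL1, flip_derivCLM, translateCLM_translateCLM, derivCLM_translateCLM, map_sub,
      map_smul, map_neg, smul_eq_mul, Complex.real_smul, neg_add_rev]
    push_cast
    ring
  rw [h1, Real.norm_of_nonneg (sq_nonneg h), mul_assoc, ← neg_sq]
  refine (hT _).trans ?_
  gcongr
  exact hK (-h)

/-- The sign in the definition of `T'` cancels the one produced by reflection. -/
theorem convDL1_deriv (T : BoundedDistribution) (ψ : DL1) :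
    T.deriv.convDL1 ψ = T.convDL1 (derivCLM ψ) := funext fun x => by
  change -(T (derivCLM _)) = T _
  rw [flip_derivCLM, map_neg, map_neg, derivCLM_translateCLM]

theorem convDL1_iterate_deriv (T : BoundedDistribution) (i : ℕ) (ψ : DL1) :
    (BoundedDistribution.deriv^[i] T).convDL1 ψ = T.convDL1 (derivCLM^[i] ψ) := by
  induction i generalizing T with
  | zero => rfl
  | succ n ih =>
    rw [Function.iterate_succ_apply, ih, convDL1_deriv, Function.iterate_succ_apply']

theorem convDL1_translate (T : BoundedDistribution) (h : ℝ) (ψ : DL1) :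
    (T.translate h).convDL1 ψ = T.convDL1 (translateCLM h ψ) := funext fun x => by
  change T (translateCLM (-h) (translateCLM (-x) (flip ψ))) = T _
  rw [flip_translateCLM, translateCLM_translateCLM, translateCLM_translateCLM, add_comm]

theorem convDL1_opDist {p q : ℕ} (a : Fin (p + 1) → Fin (q + 1) → ℂ) (h : Fin (q + 1) → ℝ)
    (T : BoundedDistribution) (ψ : DL1) :
    (opDist a h T).convDL1 ψ = T.convDL1 (∑ i : Fin (p + 1), ∑ j : Fin (q + 1),
      a i j • translateCLM (h j) (derivCLM^[(i : ℕ)] ψ)) := by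
  funext x
  simp only [convDL1_sum, convDL1_smul, ← convDL1_translate, ← convDL1_iterate_deriv]
  simp only [convDL1, opDist, sum_apply, smul_apply, smul_eq_mul]

end BoundedDistribution

open scoped SchwartzMap FourierTransform

/-! ### Schwartz functions as elements of `D_{L^1}` -/

theorem iteratedDeriv_schwartz (i : ℕ) (k : 𝓢(ℝ, ℂ)) :
    iteratedDeriv i k = ((SchwartzMap.derivCLM ℂ ℂ)^[i] k : 𝓢(ℝ, ℂ)) := by
  induction i generalizing k with
  | zero => simp
  | succ n ih => rw [iteratedDeriv_succ', Function.iterate_succ_apply, ← ih]; rfl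

/-- A Schwartz function as an element of `D_{L^1}`. -/
def schwartzToDL1 : 𝓢(ℝ, ℂ) →ₗ[ℂ] DL1 where
  toFun k := ⟨k, k.smooth ⊤, fun i => by
    rw [iteratedDeriv_schwartz]
    exact SchwartzMap.integrable _⟩
  map_add' _ _ := rfl
  map_smul' _ _ := rfl

theorem schwartzToDL1_derivCLM (k : 𝓢(ℝ, ℂ)) :
    schwartzToDL1 (SchwartzMap.derivCLM ℂ ℂ k) = DL1.derivCLM (schwartzToDL1 k) := rfl

theorem schwartzToDL1_compSubConstCLM (h : ℝ) (k : 𝓢(ℝ, ℂ)) :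
    schwartzToDL1 (SchwartzMap.compSubConstCLM ℂ (-h) k) =
      DL1.translateCLM h (schwartzToDL1 k) :=
  DL1.ext fun x => congrArg k (sub_neg_eq_add x h)

theorem continuous_seminorm_schwartzToDL1 (m : ℕ) :
    Continuous fun k => DL1.seminorm m (schwartzToDL1 k) := by
  have : (fun k => DL1.seminorm m (schwartzToDL1 k)) = fun k : 𝓢(ℝ, ℂ) =>
      ∑ i ∈ Finset.range (m + 1),
        ‖SchwartzMap.toLpCLM ℂ ℂ 1 volume ((SchwartzMap.derivCLM ℂ ℂ)^[i] k)‖ := by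
    funext k
    rw [DL1.seminorm_apply]
    refine Finset.sum_congr rfl fun i _ => ?_
    rw [SchwartzMap.toLpCLM_apply, SchwartzMap.norm_toLp_one, ← iteratedDeriv_schwartz]
    rfl
  rw [this]
  refine continuous_finsetSum _ fun i _ => ((ContinuousLinearMap.continuous _).comp ?_).norm
  exact (SchwartzMap.derivCLM ℂ ℂ).continuous.iterate i

/-! ### Density of compactly supported functions -/

/-- Derivatives of the complementary cutoff `x ↦ θ (c x)` are `O(c |x|)`. -/
theorem exists_iteratedFDeriv_cutoff_le {θ : ℝ → ℝ} (hθ : ContDiff ℝ ∞ θ)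
    (h0 : ∀ x, ‖x‖ < 1 → θ x = 0) (h1 : HasCompactSupport fun x => 1 - θ x) (i : ℕ) :
    ∃ C, 0 ≤ C ∧ ∀ c : ℝ, 0 < c → c ≤ 1 → ∀ x,
      ‖iteratedFDeriv ℝ i (fun x => θ (c * x)) x‖ ≤ C * (c * ‖x‖) := by
  have hb : ∃ C, ∀ x, ‖iteratedDeriv i θ x‖ ≤ C := by
    have hs : ContDiff ℝ ∞ fun x => 1 - θ x := contDiff_const.sub hθ
    obtain ⟨C, hC⟩ := (hs.continuous_iteratedFDeriv (m := i)
      (by exact_mod_cast le_top)).bounded_above_of_compact_support (h1.iteratedFDeriv i)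
    refine ⟨C + 1, fun x => ?_⟩
    have hx := hC x
    rw [norm_iteratedFDeriv_eq_norm_iteratedDeriv] at hx
    -- Only `1 - θ` has compact support; `θ` itself tends to `1`, hence the bound `C + 1`.
    rcases Nat.eq_zero_or_pos i with rfl | hi
    · simp only [iteratedDeriv_zero] at hx ⊢
      calc ‖θ x‖ = ‖1 - (1 - θ x)‖ := by congr 1; ring
        _ ≤ ‖(1 : ℝ)‖ + ‖1 - θ x‖ := norm_sub_le _ _
        _ ≤ C + 1 := by rw [norm_one]; linarith
    · rw [iteratedDeriv_const_sub hi, iteratedDeriv_neg, norm_neg] at hx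
      linarith
  obtain ⟨C, hC⟩ := hb
  refine ⟨C, (norm_nonneg _).trans (hC 0), fun c hc hc1 x => ?_⟩
  have hd : ‖iteratedFDeriv ℝ i (fun x => θ (c * x)) x‖ = c ^ i * ‖iteratedDeriv i θ (c * x)‖ := by
    rw [norm_iteratedFDeriv_eq_norm_iteratedDeriv,
      iteratedDeriv_comp_const_mul (contDiff_infty.1 hθ i), norm_mul, norm_pow,
      Real.norm_of_nonneg hc.le]
  rw [hd]
  have hcx : ‖c * x‖ = c * ‖x‖ := by rw [norm_mul, Real.norm_of_nonneg hc.le]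
  -- Either `θ` vanishes near `c * x`, or the factor `c * ‖x‖` is at least one.
  rcases lt_or_ge (c * ‖x‖) 1 with h | h
  · have : θ =ᶠ[𝓝 (c * x)] fun _ => 0 := by
      filter_upwards [continuous_norm.continuousAt.eventually_lt_const (hcx.trans_lt h)] with y hy
      exact h0 y hy
    rw [this.iteratedDeriv_eq, iteratedDeriv_const]
    have : 0 ≤ C := (norm_nonneg _).trans (hC 0)
    simp only [ite_self, norm_zero, mul_zero]
    positivity
  · calc c ^ i * ‖iteratedDeriv i θ (c * x)‖ ≤ 1 * C :=
        mul_le_mul (pow_le_one₀ hc.le hc1) (hC _) (norm_nonneg _) zero_le_one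
      _ ≤ C * (c * ‖x‖) := by
        rw [one_mul]
        exact le_mul_of_one_le_right ((norm_nonneg _).trans (hC 0)) h

/-- By Leibniz, the factor `‖x‖` from the cutoff is absorbed by one more power of the weight on `k`,
leaving a gain of `c`. -/
theorem exists_schwartz_seminorm_cutoff_le {θ : ℝ → ℝ} (hθ : ContDiff ℝ ∞ θ)
    (h0 : ∀ x, ‖x‖ < 1 → θ x = 0) (h1 : HasCompactSupport fun x => 1 - θ x) (k : 𝓢(ℝ, ℂ))
    (l n : ℕ) : ∃ C, ∀ c : ℝ, 0 < c → c ≤ 1 → ∀ f : 𝓢(ℝ, ℂ), (∀ x, f x = θ (c * x) • k x) →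
      SchwartzMap.seminorm ℂ l n f ≤ C * c := by
  choose C hC0 hC using fun i => exists_iteratedFDeriv_cutoff_le hθ h0 h1 i
  refine ⟨∑ i ∈ Finset.range (n + 1), n.choose i * C i * SchwartzMap.seminorm ℂ (l + 1) (n - i) k,
    fun c hc hc1 f hf => ?_⟩
  refine SchwartzMap.seminorm_le_bound ℂ l n f
    (mul_nonneg (Finset.sum_nonneg fun i _ => ?_) hc.le) fun x => ?_
  · have := hC0 i
    positivity
  rw [show (f : ℝ → ℂ) = fun x => θ (c * x) • k x from funext hf]
  have hL := norm_iteratedFDeriv_smul_le (𝕜 := ℝ) (f := fun x => θ (c * x)) (g := k)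
    (contDiff_infty.1 (hθ.comp (contDiff_const.mul contDiff_id)) n)
    (contDiff_infty.1 (k.smooth ⊤) n) x le_rfl
  refine (mul_le_mul_of_nonneg_left hL (by positivity)).trans ?_
  rw [Finset.mul_sum, Finset.sum_mul]
  refine Finset.sum_le_sum fun i _ => ?_
  have h2 := SchwartzMap.le_seminorm ℂ (l + 1) (n - i) k x
  calc ‖x‖ ^ l * (n.choose i * ‖iteratedFDeriv ℝ i (fun x => θ (c * x)) x‖ *
        ‖iteratedFDeriv ℝ (n - i) k x‖)
      ≤ ‖x‖ ^ l * (n.choose i * (C i * (c * ‖x‖)) * ‖iteratedFDeriv ℝ (n - i) k x‖) := by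
        gcongr
        exact hC i c hc hc1 x
    _ = n.choose i * C i * (‖x‖ ^ (l + 1) * ‖iteratedFDeriv ℝ (n - i) k x‖) * c := by ring
    _ ≤ _ := by
        have := hC0 i
        gcongr

/-- Smooth compactly supported functions are dense in the Schwartz space. -/
theorem dense_hasCompactSupport_schwartz : Dense {k : 𝓢(ℝ, ℂ) | HasCompactSupport k} := by
  intro k
  obtain ⟨b, hb, hb1, hbs⟩ : ∃ b : ℝ → ℝ, ContDiff ℝ ∞ b ∧ (∀ x, ‖x‖ < 1 → b x = 1) ∧
      HasCompactSupport b := by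
    let b : ContDiffBump (0 : ℝ) := ⟨1, 2, one_pos, one_lt_two⟩
    exact ⟨b, b.contDiff, fun x hx => b.one_of_mem_closedBall (by simpa using hx.le),
      b.hasCompactSupport⟩
  obtain ⟨c, hc, hc1, hlim⟩ : ∃ c : ℕ → ℝ, (∀ N, 0 < c N) ∧ (∀ N, c N ≤ 1) ∧
      Tendsto c atTop (𝓝 0) := by
    refine ⟨fun N => 1 / ((N : ℝ) + 1), fun N => by positivity, fun N => ?_,
      tendsto_one_div_add_atTop_nhds_zero_nat⟩
    rw [div_le_one (by positivity)]
    linarith [(N.cast_nonneg : (0 : ℝ) ≤ N)]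
  have hs : ∀ N, HasCompactSupport fun x => b (c N * x) • k x := fun N => by
    have h : HasCompactSupport fun x => b (c N * x) :=
      hbs.comp_homeomorph (Homeomorph.mulLeft₀ (c N) (hc N).ne')
    exact h.smul_right
  have hd : ∀ N, ContDiff ℝ ∞ fun x => b (c N * x) • k x := fun N => by
    have h : ContDiff ℝ ∞ fun x => b (c N * x) := hb.comp (contDiff_const.mul contDiff_id)
    exact h.smul (k.smooth ⊤)
  refine mem_closure_of_tendsto (f := fun N => (hs N).toSchwartzMap (hd N)) (b := atTop) ?_
    (Eventually.of_forall fun N => hs N)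
  rw [(schwartz_withSeminorms ℂ ℝ ℂ).tendsto_nhds]
  rintro ⟨l, n⟩ ε hε
  obtain ⟨C, hC⟩ := exists_schwartz_seminorm_cutoff_le (θ := fun x => 1 - b x)
    (contDiff_const.sub hb) (fun x hx => by rw [hb1 x hx, sub_self])
    (by simpa using hbs) k l n
  have hlim' := hlim.const_mul C
  rw [mul_zero] at hlim'
  filter_upwards [hlim'.eventually_lt_const hε] with N hN
  rw [map_sub_rev]
  have h1 : SchwartzMap.seminorm ℂ l n (k - (hs N).toSchwartzMap (hd N)) ≤ C * c N := by
    refine hC (c N) (hc N) (hc1 N) _ fun x => ?_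
    rw [sub_apply, HasCompactSupport.toSchwartzMap_toFun, sub_smul, one_smul]
  exact h1.trans_lt hN

/-! ### Almost automorphic distributions and Schwartz functions -/

/-- Schwartz approximation of `k` makes `T ∗ k` a uniform limit. -/
theorem isAlmostAutomorphic_convDL1_of_dense (T : BoundedDistribution) {D : Set 𝓢(ℝ, ℂ)}
    (hD : Dense D) (h : ∀ k ∈ D, IsAlmostAutomorphic (T.convDL1 (schwartzToDL1 k)))
    (k : 𝓢(ℝ, ℂ)) : IsAlmostAutomorphic (T.convDL1 (schwartzToDL1 k)) := by
  obtain ⟨m, C, hC, hT⟩ := T.exists_norm_le_seminorm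
  refine isAlmostAutomorphic_of_forall_exists_norm_sub_le fun ε hε => ?_
  have hU : {l | DL1.seminorm m (schwartzToDL1 (k - l)) < ε / C} ∈ 𝓝 k := by
    have hcont : Continuous fun l => DL1.seminorm m (schwartzToDL1 (k - l)) :=
      (continuous_seminorm_schwartzToDL1 m).comp (continuous_const.sub continuous_id)
    refine hcont.continuousAt.eventually_lt_const ?_
    simp only [sub_self, map_zero]
    positivity
  obtain ⟨l, hlD, hl⟩ := hD.inter_nhds_nonempty hU
  refine ⟨_, h l hlD, fun x => ?_⟩
  have h1 := T.convDL1_add (schwartzToDL1 (k - l)) (schwartzToDL1 l) x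
  rw [← map_add, sub_add_cancel] at h1
  rw [h1, add_sub_cancel_right]
  refine (BoundedDistribution.norm_convDL1_le hT _ x).trans ?_
  rw [← le_div_iff₀' hC]
  exact le_of_lt hl

theorem IsAlmostAutomorphicDistribution.convDL1 {T : BoundedDistribution}
    (hT : IsAlmostAutomorphicDistribution T) (k : 𝓢(ℝ, ℂ)) :
    IsAlmostAutomorphic (T.convDL1 (schwartzToDL1 k)) :=
  isAlmostAutomorphic_convDL1_of_dense T dense_hasCompactSupport_schwartz
    (fun k hk => hT ⟨k, k.smooth ⊤, hk, fun _ _ => trivial⟩) k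

theorem isAlmostAutomorphicDistribution_of_forall_schwartz {T : BoundedDistribution}
    (h : ∀ k : 𝓢(ℝ, ℂ), IsAlmostAutomorphic (T.convDL1 (schwartzToDL1 k))) :
    IsAlmostAutomorphicDistribution T :=
  fun φ => h (φ.hasCompactSupport.toSchwartzMap φ.contDiff)

open scoped Manifold

/-! ### The operator on Schwartz functions and its symbol -/

theorem fourier_derivCLM_apply (k : 𝓢(ℝ, ℂ)) (ξ : ℝ) :
    𝓕 (SchwartzMap.derivCLM ℂ ℂ k) ξ = 2 * Real.pi * Complex.I * ξ * 𝓕 k ξ := by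
  rw [SchwartzMap.fourier_coe, SchwartzMap.fourier_coe]
  exact congrFun (Real.fourier_deriv k.integrable k.differentiable
    (SchwartzMap.derivCLM ℂ ℂ k).integrable) ξ

theorem fourier_compSubConstCLM_apply (h : ℝ) (k : 𝓢(ℝ, ℂ)) (ξ : ℝ) :
    𝓕 (SchwartzMap.compSubConstCLM ℂ (-h) k) ξ =
      Complex.exp (2 * Real.pi * Complex.I * ξ * h) * 𝓕 k ξ := by
  rw [SchwartzMap.fourier_coe, SchwartzMap.fourier_coe,
    Real.fourier_real_eq_integral_exp_smul, Real.fourier_real_eq_integral_exp_smul,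
    ← integral_const_mul, ← integral_sub_right_eq_self _ h]
  refine integral_congr_ae (Eventually.of_forall fun v => ?_)
  simp only [SchwartzMap.compSubConstCLM_apply, sub_neg_eq_add, sub_add_cancel, smul_eq_mul]
  rw [← mul_assoc, ← Complex.exp_add]
  congr 2
  push_cast
  ring

variable {p q : ℕ}

/-- The operator `∑ a_{ij} (d/dx)^i τ_{h_j}` on Schwartz functions. -/
def opSchwartz (a : Fin (p + 1) → Fin (q + 1) → ℂ) (h : Fin (q + 1) → ℝ) (k : 𝓢(ℝ, ℂ)) :
    𝓢(ℝ, ℂ) :=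
  ∑ i : Fin (p + 1), ∑ j : Fin (q + 1), a i j •
    SchwartzMap.compSubConstCLM ℂ (-(h j)) ((SchwartzMap.derivCLM ℂ ℂ)^[(i : ℕ)] k)

/-- The symbol `ξ ↦ ∑ a_{ij} (2πiξ)^i exp (2πiξ h_j)` of the operator. -/
def symbol (a : Fin (p + 1) → Fin (q + 1) → ℂ) (h : Fin (q + 1) → ℝ) (ξ : ℝ) : ℂ :=
  ∑ i : Fin (p + 1), ∑ j : Fin (q + 1), a i j *
    (Complex.exp (2 * Real.pi * Complex.I * ξ * h j) * (2 * Real.pi * Complex.I * ξ) ^ (i : ℕ))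

theorem fourier_opSchwartz_apply (a : Fin (p + 1) → Fin (q + 1) → ℂ) (h : Fin (q + 1) → ℝ)
    (k : 𝓢(ℝ, ℂ)) (ξ : ℝ) : 𝓕 (opSchwartz a h k) ξ = symbol a h ξ * 𝓕 k ξ := by
  have hi : ∀ i : ℕ, 𝓕 ((SchwartzMap.derivCLM ℂ ℂ)^[i] k) ξ =
      (2 * Real.pi * Complex.I * ξ) ^ i * 𝓕 k ξ := fun i => by
    induction i with
    | zero => simp
    | succ n ih => rw [Function.iterate_succ_apply', fourier_derivCLM_apply, ih]; ring
  simp only [opSchwartz, symbol, FourierTransform.fourier_sum, FourierTransform.fourier_smul,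
    sum_apply, smul_apply, Finset.sum_mul, fourier_compSubConstCLM_apply, hi, smul_eq_mul,
    mul_assoc]

theorem opFun_schwartz (a : Fin (p + 1) → Fin (q + 1) → ℂ) (h : Fin (q + 1) → ℝ)
    (k : 𝓢(ℝ, ℂ)) (x : ℝ) : opFun a h k x = opSchwartz a h k x := by
  simp only [opFun, opSchwartz, sum_apply, smul_apply, iteratedDeriv_comp_add_const,
    iteratedDeriv_schwartz, SchwartzMap.compSubConstCLM_apply, sub_neg_eq_add, smul_eq_mul]

theorem schwartzToDL1_opSchwartz (a : Fin (p + 1) → Fin (q + 1) → ℂ) (h : Fin (q + 1) → ℝ)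
    (k : 𝓢(ℝ, ℂ)) : schwartzToDL1 (opSchwartz a h k) = ∑ i : Fin (p + 1), ∑ j : Fin (q + 1),
      a i j • DL1.translateCLM (h j) (DL1.derivCLM^[(i : ℕ)] (schwartzToDL1 k)) := by
  have hi : ∀ i : ℕ, schwartzToDL1 ((SchwartzMap.derivCLM ℂ ℂ)^[i] k) =
      DL1.derivCLM^[i] (schwartzToDL1 k) := fun i => by
    induction i with
    | zero => rfl
    | succ n ih =>
      rw [Function.iterate_succ_apply', Function.iterate_succ_apply', schwartzToDL1_derivCLM, ih]
  simp only [opSchwartz, map_sum, map_smul, schwartzToDL1_compSubConstCLM, hi]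

theorem analyticAt_symbol (a : Fin (p + 1) → Fin (q + 1) → ℂ) (h : Fin (q + 1) → ℝ) (ξ : ℝ) :
    AnalyticAt ℝ (symbol a h) ξ := by
  have h1 : Differentiable ℂ fun z : ℂ => ∑ i : Fin (p + 1), ∑ j : Fin (q + 1), a i j *
      (Complex.exp (2 * Real.pi * Complex.I * z * h j) *
        (2 * Real.pi * Complex.I * z) ^ (i : ℕ)) := by
    fun_prop
  exact ((h1.analyticAt ξ).restrictScalars (𝕜 := ℝ)).comp (Complex.ofRealCLM.analyticAt ξ)

/-! ### Nonvanishing of the symbol -/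

theorem isCpub_schwartz (n : ℕ) (k : 𝓢(ℝ, ℂ)) : IsCpub n k := by
  refine ⟨contDiff_infty.1 (k.smooth ⊤) n, fun i _ => ?_⟩
  rw [iteratedDeriv_schwartz]
  set l := (SchwartzMap.derivCLM ℂ ℂ)^[i] k
  exact ⟨ZeroAtInftyContinuousMap.uniformContinuous l.toZeroAtInfty,
    _, l.toBoundedContinuousFunction.norm_coe_le_norm⟩

/-- Along translations going to `+∞` the limit function is `0`, and translating back returns `f`. -/
theorem eq_zero_of_isAlmostAutomorphic_of_tendsto {f : ℝ → ℂ} (hf : IsAlmostAutomorphic f)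
    (h0 : Tendsto f atTop (𝓝 0)) (x : ℝ) : f x = 0 := by
  obtain ⟨k, hk, g, hg, hg'⟩ := hf.exists_translatesReturn fun n => n
  have hs : ∀ y : ℝ, Tendsto (fun n => y + ((k n : ℕ) : ℝ)) atTop atTop := fun y =>
    tendsto_atTop_add_const_left _ _ (tendsto_natCast_atTop_atTop.comp hk.tendsto_atTop)
  have hg0 : ∀ y, g y = 0 := fun y => tendsto_nhds_unique (hg y) (h0.comp (hs y))
  simp only [hg0] at hg'
  exact tendsto_nhds_unique (hg' x) tendsto_const_nhds

theorem exists_symbol_ne_zero (a : Fin (p + 1) → Fin (q + 1) → ℂ) (h : Fin (q + 1) → ℝ)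
    (hom : ∀ f : ℝ → ℂ, IsCpub p f → (∀ x : ℝ, opFun a h f x = 0) → IsAlmostAutomorphic f) :
    ∃ ξ, symbol a h ξ ≠ 0 := by
  by_contra! h0
  let b : ContDiffBump (0 : ℝ) := ⟨1, 2, one_pos, one_lt_two⟩
  have hs : HasCompactSupport fun x => (b x : ℂ) :=
    b.hasCompactSupport.comp_left Complex.ofReal_zero
  let k : 𝓢(ℝ, ℂ) := hs.toSchwartzMap (Complex.ofRealCLM.contDiff.comp b.contDiff)
  -- With zero symbol the operator kills every Schwartz function, in particular a bump.
  have hk : opSchwartz a h k = 0 := by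
    have h1 : 𝓕 (opSchwartz a h k) = 0 := by
      ext ξ
      rw [fourier_opSchwartz_apply, h0, zero_mul]
      rfl
    exact (FourierTransform.fourierCLE ℂ 𝓢(ℝ, ℂ)).map_eq_zero_iff.1 h1
  have haa : IsAlmostAutomorphic k := hom k (isCpub_schwartz p k) fun x => by
    rw [opFun_schwartz, hk]
    rfl
  have h2 := eq_zero_of_isAlmostAutomorphic_of_tendsto haa
    (k.tendsto_cocompact.mono_left atTop_le_cocompact) 0
  have h3 : b 0 = 1 := b.one_of_mem_closedBall (by simp [b])
  change ((b 0 : ℝ) : ℂ) = 0 at h2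
  rw [h3] at h2
  exact one_ne_zero (by exact_mod_cast h2 : (1 : ℝ) = 0)

/-! ### Localization on the Fourier side -/

/-- The operator `d/dx - 2πic` on Schwartz functions. -/
def derivSub (c : ℝ) (k : 𝓢(ℝ, ℂ)) : 𝓢(ℝ, ℂ) :=
  SchwartzMap.derivCLM ℂ ℂ k + (-(2 * Real.pi * Complex.I * c) : ℂ) • k

theorem fourier_iterate_derivSub_apply (c : ℝ) (n : ℕ) (k : 𝓢(ℝ, ℂ)) (ξ : ℝ) :
    𝓕 ((derivSub c)^[n] k) ξ = (2 * Real.pi * Complex.I * (ξ - c)) ^ n * 𝓕 k ξ := by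
  induction n with
  | zero => simp
  | succ n ih =>
    rw [Function.iterate_succ_apply', derivSub, FourierAdd.fourier_add,
      FourierTransform.fourier_smul, add_apply, smul_apply, fourier_derivCLM_apply, ih,
      smul_eq_mul]
    ring

/-- Each factor `d/dx - 2πic` is removed by the Bohr type theorem, as convolutions with `T` are
bounded. -/
theorem isAlmostAutomorphic_convDL1_of_iterate_derivSub (T : BoundedDistribution) (c : ℝ) (n : ℕ)
    (k : 𝓢(ℝ, ℂ))
    (h : IsAlmostAutomorphic (T.convDL1 (schwartzToDL1 ((derivSub c)^[n] k)))) :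
    IsAlmostAutomorphic (T.convDL1 (schwartzToDL1 k)) := by
  induction n with
  | zero => exact h
  | succ n ih =>
    refine ih ?_
    rw [Function.iterate_succ_apply'] at h
    set l := (derivSub c)^[n] k
    refine h.of_hasDerivAt_add (2 * Real.pi * c) (fun x => ?_) (T.exists_norm_convDL1_le _)
    refine (T.hasDerivAt_convDL1 _ x).congr_deriv ?_
    have h1 : SchwartzMap.derivCLM ℂ ℂ l =
        derivSub c l + (2 * Real.pi * Complex.I * c : ℂ) • l := by
      rw [derivSub, add_assoc, ← add_smul, neg_add_cancel, zero_smul, add_zero]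
    rw [← schwartzToDL1_derivCLM, h1, map_add, map_smul, T.convDL1_add, T.convDL1_smul]
    push_cast
    ring

theorem fourier_injective {k l : 𝓢(ℝ, ℂ)} (h : ∀ ξ, 𝓕 k ξ = 𝓕 l ξ) : k = l :=
  (FourierTransform.fourierCLE ℂ 𝓢(ℝ, ℂ)).injective (SchwartzMap.ext h)

/-- Near each frequency the symbol is a power of a linear function times an invertible smooth
function, so that convolutions with test functions of nearby frequencies are almost automorphic. -/
theorem exists_nhds_isAlmostAutomorphic_convDL1 (a : Fin (p + 1) → Fin (q + 1) → ℂ)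
    (h : Fin (q + 1) → ℝ) (hne : ∃ ξ, symbol a h ξ ≠ 0) {T : BoundedDistribution}
    (hT : IsAlmostAutomorphicDistribution (opDist a h T)) (c : ℝ) :
    ∃ U : Set ℝ, IsOpen U ∧ c ∈ U ∧ ∀ m : 𝓢(ℝ, ℂ), HasCompactSupport m → tsupport m ⊆ U →
      IsAlmostAutomorphic (T.convDL1 (schwartzToDL1 (𝓕⁻ m))) := by
  -- Identity theorem: local vanishing would propagate to all of `ℝ`.
  have hnz : ¬∀ᶠ ξ in 𝓝 c, symbol a h ξ = 0 := fun h0 => by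
    obtain ⟨ξ, hξ⟩ := hne
    exact hξ (AnalyticOnNhd.eqOn_zero_of_preconnected_of_eventuallyEq_zero
      (fun ξ _ => analyticAt_symbol a h ξ) isPreconnected_univ (Set.mem_univ c) h0
      (Set.mem_univ ξ))
  obtain ⟨n, g, hg, hgc, hgs⟩ :=
    (analyticAt_symbol a h c).exists_eventuallyEq_pow_smul_nonzero_iff.2 hnz
  obtain ⟨U, hU, hUo, hcU⟩ := eventually_nhds_iff.1
    (hg.eventually_analyticAt.and ((hg.continuousAt.eventually_ne hgc).and hgs))
  refine ⟨U, hUo, hcU, fun m hm hmU => ?_⟩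
  have hs : HasCompactSupport fun ξ => m ξ * (g ξ)⁻¹ := hm.mul_right
  have hd : ContDiff ℝ ∞ fun ξ => m ξ * (g ξ)⁻¹ := by
    refine contDiff_iff_contDiffAt.2 fun ξ => ?_
    by_cases hξ : ξ ∈ tsupport m
    · obtain ⟨h1, h2, -⟩ := hU ξ (hmU hξ)
      exact (m.smooth ⊤).contDiffAt.mul (h1.contDiffAt.inv h2)
    · refine (contDiffAt_const (c := (0 : ℂ))).congr_of_eventuallyEq ?_
      filter_upwards [(notMem_tsupport_iff_eventuallyEq.1 hξ)] with η hη
      rw [hη, Pi.zero_apply, zero_mul]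
  let m' : 𝓢(ℝ, ℂ) := hs.toSchwartzMap hd
  refine isAlmostAutomorphic_convDL1_of_iterate_derivSub T c n _ ?_
  -- On the Fourier side this is `(2πi(ξ - c))^n m = (ξ - c)^n g · (2πi)^n (m / g)`.
  have key : (derivSub c)^[n] (𝓕⁻ m) =
      opSchwartz a h ((2 * Real.pi * Complex.I : ℂ) ^ n • 𝓕⁻ m') := by
    refine fourier_injective fun ξ => ?_
    rw [fourier_iterate_derivSub_apply, fourier_opSchwartz_apply, FourierTransform.fourier_smul,
      smul_apply, FourierTransform.fourier_fourierInv_eq, FourierTransform.fourier_fourierInv_eq,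
      smul_eq_mul]
    change _ = symbol a h ξ * ((2 * Real.pi * Complex.I : ℂ) ^ n * (m ξ * (g ξ)⁻¹))
    by_cases hξ : ξ ∈ tsupport m
    · obtain ⟨-, h2, h3⟩ := hU ξ (hmU hξ)
      rw [h3, Complex.real_smul]
      push_cast
      rw [mul_pow]
      field_simp
    · rw [image_eq_zero_of_notMem_tsupport hξ]
      simp
  rw [key, schwartzToDL1_opSchwartz, ← BoundedDistribution.convDL1_opDist]
  exact hT.convDL1 _

/-- Compactness and a smooth partition of unity split `m` into finitely many pieces, each of
localized frequency. -/
theorem isAlmostAutomorphic_convDL1_fourierInv (a : Fin (p + 1) → Fin (q + 1) → ℂ)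
    (h : Fin (q + 1) → ℝ) (hne : ∃ ξ, symbol a h ξ ≠ 0) {T : BoundedDistribution}
    (hT : IsAlmostAutomorphicDistribution (opDist a h T)) (m : 𝓢(ℝ, ℂ))
    (hm : HasCompactSupport m) : IsAlmostAutomorphic (T.convDL1 (schwartzToDL1 (𝓕⁻ m))) := by
  choose U hUo hU hUaa using fun c => exists_nhds_isAlmostAutomorphic_convDL1 a h hne hT c
  obtain ⟨t, -, ht⟩ := hm.isCompact.elim_nhds_subcover U fun c _ => (hUo c).mem_nhds (hU c)
  obtain ⟨ρ, hρ⟩ := SmoothPartitionOfUnity.exists_isSubordinate 𝓘(ℝ, ℝ)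
    (isClosed_tsupport m) (fun c : t => U c) (fun c => hUo c) (by
      refine ht.trans fun x hx => ?_
      simpa using hx)
  have hs : ∀ c : t, HasCompactSupport fun ξ => ρ c ξ • m ξ := fun c =>
    hm.smul_left (f := fun ξ => ρ c ξ)
  have hd : ∀ c : t, ContDiff ℝ ∞ fun ξ => ρ c ξ • m ξ := fun c => by
    have h : ContDiff ℝ ∞ fun ξ => ρ c ξ := (ρ c).contMDiff.contDiff
    exact h.smul (m.smooth ⊤)
  let M : t → 𝓢(ℝ, ℂ) := fun c => (hs c).toSchwartzMap (hd c)
  have hsum : m = ∑ c, M c := by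
    ext ξ
    rw [sum_apply]
    change m ξ = ∑ c, ρ c ξ • m ξ
    rw [← Finset.sum_smul]
    by_cases hξ : ξ ∈ tsupport m
    · have := ρ.sum_eq_one hξ
      rw [finsum_eq_sum_of_fintype] at this
      rw [this, one_smul]
    · rw [image_eq_zero_of_notMem_tsupport hξ, smul_zero]
  have hconv : T.convDL1 (schwartzToDL1 (𝓕⁻ m)) =
      fun x => ∑ c, T.convDL1 (schwartzToDL1 (𝓕⁻ (M c))) x := by
    funext x
    have h1 : 𝓕⁻ m = ∑ c, 𝓕⁻ (M c) := by
      conv_lhs => rw [hsum]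
      exact map_sum (FourierTransform.fourierCLE ℂ 𝓢(ℝ, ℂ)).symm M _
    rw [h1, map_sum, T.convDL1_sum]
  rw [hconv]
  refine isAlmostAutomorphic_sum _ fun c _ => hUaa c (M c) (hs c) ?_
  exact (closure_mono (Function.support_smul_subset_left _ _)).trans (hρ c)

/-- The Fourier transform is a homeomorphism of the Schwartz space. -/
theorem dense_hasCompactSupport_fourier :
    Dense {k : 𝓢(ℝ, ℂ) | HasCompactSupport (𝓕 k : 𝓢(ℝ, ℂ))} :=
  dense_hasCompactSupport_schwartz.preimage
    (FourierTransform.fourierCLE ℂ 𝓢(ℝ, ℂ)).toHomeomorph.isOpenMap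

end AlmostAutomorphy

end

open AlmostAutomorphy
theorem mainTheorem4 (p q : ℕ) (a : Fin (p + 1) → Fin (q + 1) → ℂ) (h : Fin (q + 1) → ℝ)
    (hom : ∀ f : ℝ → ℂ, IsCpub p f → (∀ x : ℝ, opFun a h f x = 0) → IsAlmostAutomorphic f)
    (S : BoundedDistribution) (hS : IsAlmostAutomorphicDistribution S)
    (T : BoundedDistribution) (hT : opDist a h T = S) :
    IsAlmostAutomorphicDistribution T := by
  subst hT
  refine isAlmostAutomorphicDistribution_of_forall_schwartz
    (isAlmostAutomorphic_convDL1_of_dense T dense_hasCompactSupport_fourier fun k hk => ?_)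
  have := isAlmostAutomorphic_convDL1_fourierInv a h (exists_symbol_ne_zero a h hom) hS _ hk
  rwa [FourierTransform.fourierInv_fourier_eq] at this
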